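/- Let $q$ be a complex number with $0<|q|<1$. Write $(x;q)_\infty=\prod_{i\ge 0}(1-xq^i)$, $(x;q)_n=\prod_{i=0}^{n-1}(1-xq^i)$, $(x_1,\dots,x_r;q)_n=(x_1;q)_n\cdots(x_r;q)_n$ for $0\le n\le\infty$, and $$\theta(q,x)=\sum_{n=0}^{\infty}(-1)^nq^{\binom n2}x^n,\qquad P(a,b)=(q,a,b;q)_\infty\sum_{n=0}^{\infty}\frac{(ab/q^3;q)_{2n}}{(q,a,b,ab/q^3;q)_n}\,q^n .$$ Let $a,b$ be nonzero complex numbers with $a\neq b$. If none of $a$, $b$, $ab/q^3$ belongs to $\{q^{-n}:n=0,1,2,\dots\}$ (so that no denominator vanishes), then the series in $P(a,b)$ converges absolutely and $$\frac{abq+aq^2-b^2-bq^3}{q(a-b)b^2}\,\theta(q,a)-\frac{abq+bq^2-a^2-aq^3}{q(a-b)a^2}\,\theta(q,b)-\frac{1+q}{ab}=-\frac{(a-bq)(b-aq)}{a^2b^2}\,P(a,b).$$ Moreover, for all nonzero $a\ne b$ without this restriction, the same identity holds when $P(a,b)$ is read with its common factors cancelled, that is, as $$P(a,b)=(q;q)_\infty\sum_{n=0}^{\infty}\frac{(aq^n,bq^n;q)_\infty\,(abq^{n-3};q)_n}{(q;q)_n}\,q^n,$$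 a series which converges absolutely. -/

import Mathlib

noncomputable section

namespace PartialThetaIdentity

/-- The infinite `q`-shifted factorial `(x;q)_∞ = ∏_{i ≥ 0} (1 - x q^i)`. -/
def qPochInf (x q : ℂ) : ℂ := ∏' i : ℕ, (1 - x * q ^ i)

/-- The finite `q`-shifted factorial `(x;q)_n = ∏_{0 ≤ i < n} (1 - x q^i)`; see
`qPoch_mul_qPochInf` for its relation with `(x;q)_∞ / (x q^n;q)_∞`. -/
def qPoch (x q : ℂ) (n : ℕ) : ℂ := ∏ i ∈ Finset.range n, (1 - x * q ^ i)

theorem multipliable_qPochInf (x : ℂ) {q : ℂ} (hq : ‖q‖ < 1) :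
    Multipliable fun i : ℕ => 1 - x * q ^ i := by
  have h : Summable fun i : ℕ => ‖-(x * q ^ i)‖ := by
    simp only [norm_neg, norm_mul, norm_pow]
    exact (summable_geometric_of_lt_one (norm_nonneg q) hq).mul_left _
  simpa [sub_eq_add_neg] using multipliable_one_add_of_summable h

/-- `(x;q)_n (x q^n;q)_∞ = (x;q)_∞`. -/
theorem qPoch_mul_qPochInf (x : ℂ) {q : ℂ} (hq : ‖q‖ < 1) (n : ℕ) :
    qPoch x q n * qPochInf (x * q ^ n) q = qPochInf x q := by
  have key : ∀ y : ℂ, (1 - y) * qPochInf (y * q) q = qPochInf y q := by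
    intro y
    have h1 : Multipliable fun i : ℕ => 1 - y * q ^ (i + 1) := by
      simpa [pow_succ', mul_assoc] using multipliable_qPochInf (y * q) hq
    have := tprod_eq_zero_mul' (f := fun i : ℕ => 1 - y * q ^ i) h1
    unfold qPochInf
    rw [this]
    simp [pow_succ', mul_assoc]
  induction n with
  | zero => simp [qPoch]
  | succ k ih =>
    rw [← ih, ← key (x * q ^ k)]
    simp only [qPoch, Finset.prod_range_succ, pow_succ]
    ring_nf

/-- The partial theta function `θ(q,x) = ∑_{n ≥ 0} (-1)^n q^{n(n-1)/2} x^n`. -/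
def partialTheta (q x : ℂ) : ℂ := ∑' n : ℕ, (-1) ^ n * q ^ (n.choose 2) * x ^ n

theorem summable_partialTheta (x : ℂ) {q : ℂ} (hq : ‖q‖ < 1) :
    Summable fun n : ℕ => (-1) ^ n * q ^ (n.choose 2) * x ^ n := by
  have hlim : Filter.Tendsto (fun n : ℕ => ‖q‖ ^ n * ‖x‖) Filter.atTop (nhds 0) := by
    simpa using (tendsto_pow_atTop_nhds_zero_of_lt_one (norm_nonneg q) hq).mul_const ‖x‖
  have hev := hlim.eventually (gt_mem_nhds (show (0 : ℝ) < 1 / 2 by norm_num))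
  refine summable_of_ratio_norm_eventually_le (r := 1 / 2) (by norm_num) ?_
  filter_upwards [hev] with n hn
  have e : (n + 1).choose 2 = n + n.choose 2 := by
    rw [Nat.choose_succ_succ' n 1, Nat.choose_one_right]
  simp only [norm_mul, norm_pow, norm_neg, norm_one, one_pow, one_mul, e]
  calc ‖q‖ ^ (n + n.choose 2) * ‖x‖ ^ (n + 1)
      = (‖q‖ ^ n * ‖x‖) * (‖q‖ ^ n.choose 2 * ‖x‖ ^ n) := by ring
    _ ≤ 1 / 2 * (‖q‖ ^ n.choose 2 * ‖x‖ ^ n) := by gcongr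

/-- The `n`-th term `(ab/q³;q)_{2n} / (q,a,b,ab/q³;q)_n · q^n` of the series in `P(a,b)`. -/
def PTerm (q a b : ℂ) (n : ℕ) : ℂ :=
  qPoch (a * b / q ^ 3) q (2 * n) /
    (qPoch q q n * qPoch a q n * qPoch b q n * qPoch (a * b / q ^ 3) q n) * q ^ n

/-- `P(a,b) = (q,a,b;q)_∞ ∑_{n ≥ 0} (ab/q³;q)_{2n} / (q,a,b,ab/q³;q)_n · q^n`. -/
def P (q a b : ℂ) : ℂ :=
  qPochInf q q * qPochInf a q * qPochInf b q * ∑' n : ℕ, PTerm q a b n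

/-- The `n`-th term of `P(a,b)` with the common factors cancelled, by
`(a;q)_∞ / (a;q)_n = (a q^n;q)_∞`, the same for `b`, and
`(c;q)_{2n} / (c;q)_n = (c q^n;q)_n` for `c = ab/q³`. It makes sense for all `a`, `b`. -/
def PCancelledTerm (q a b : ℂ) (n : ℕ) : ℂ :=
  qPochInf (a * q ^ n) q * qPochInf (b * q ^ n) q * qPoch (a * b / q ^ 3 * q ^ n) q n /
    qPoch q q n * q ^ n

/-- `P(a,b)` with the common factors cancelled. -/
def PCancelled (q a b : ℂ) : ℂ := qPochInf q q * ∑' n : ℕ, PCancelledTerm q a b n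

/-- The left-hand side of the identity. -/
def thetaSide (q a b : ℂ) : ℂ :=
  (a * b * q + a * q ^ 2 - b ^ 2 - b * q ^ 3) / (q * (a - b) * b ^ 2) * partialTheta q a
    - (a * b * q + b * q ^ 2 - a ^ 2 - a * q ^ 3) / (q * (a - b) * a ^ 2) * partialTheta q b
    - (1 + q) / (a * b)

end PartialThetaIdentity

end

open Filter Topology

namespace PartialThetaIdentity

/-! Free the third parameter: let S(a,b,c) = ∑ (aq^n, bq^n;q)_∞ (cq^n;q)_n q^n / (q;q)_n, so that P
is (q;q)_∞ S(a,b,ab/q³). At c = ab/q the sum factors: (q;q)_∞ S(a,b,ab/q) = θ(q,a) θ(q,b)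
(`qPochInf_mul_cSum`), because in a it satisfies, up to a constant factor, the functional equation
θ(q,x) = 1 - xθ(q,xq), which has only one solution with a limit along aq^N. The relation
(b-a)S(a,b,c) = bS(a/q,b,c) - aS(a,b/q,c) (`sub_mul_cSum`) then lowers c/(ab) by a factor q. One use
reaches ab/q², a second reaches ab/q³; the second calls the ab/q² formula at (a/q,b) and (a,b/q),
which produces the factors b-aq and a-bq. -/

/-! ### Bounds, limits and nonvanishing of q-shifted factorials -/

/-- The exponential bound for `‖(x;q)_n‖`, uniform in `n`. -/
noncomputable def qPochBound (x q : ℂ) : ℝ := Real.exp (‖x‖ * (1 - ‖q‖)⁻¹)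

theorem qPochBound_pos (x q : ℂ) : 0 < qPochBound x q := Real.exp_pos _

theorem qPochBound_mono {x y q : ℂ} (hq : ‖q‖ < 1) (h : ‖x‖ ≤ ‖y‖) :
    qPochBound x q ≤ qPochBound y q := by
  have : 0 < 1 - ‖q‖ := by linarith
  unfold qPochBound
  gcongr

theorem norm_mul_pow_le (x : ℂ) {q : ℂ} (hq : ‖q‖ < 1) (n : ℕ) : ‖x * q ^ n‖ ≤ ‖x‖ := by
  rw [norm_mul, norm_pow]
  exact mul_le_of_le_one_right (norm_nonneg _) (pow_le_one₀ (norm_nonneg _) hq.le)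

theorem norm_qPoch_sub_one_le (x : ℂ) {q : ℂ} (hq : ‖q‖ < 1) (n : ℕ) :
    ‖qPoch x q n - 1‖ ≤ qPochBound x q - 1 := by
  have h := Finset.norm_prod_one_add_sub_one_le (Finset.range n) (fun i => -(x * q ^ i))
  simp only [← sub_eq_add_neg, norm_neg, norm_mul, norm_pow, ← Finset.mul_sum] at h
  refine h.trans (sub_le_sub_right (Real.exp_le_exp.2 ?_) _)
  gcongr
  rw [← tsum_geometric_of_lt_one (norm_nonneg q) hq]
  exact (summable_geometric_of_lt_one (norm_nonneg q) hq).sum_le_tsum _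
    (fun i _ => by positivity)

theorem norm_qPoch_le (x : ℂ) {q : ℂ} (hq : ‖q‖ < 1) (n : ℕ) :
    ‖qPoch x q n‖ ≤ qPochBound x q := by
  have h := norm_le_norm_sub_add (qPoch x q n) 1
  have h' := norm_qPoch_sub_one_le x hq n
  rw [norm_one] at h
  linarith

theorem tendsto_qPoch (x : ℂ) {q : ℂ} (hq : ‖q‖ < 1) :
    Tendsto (qPoch x q) atTop (𝓝 (qPochInf x q)) :=
  (multipliable_qPochInf x hq).tendsto_prod_tprod_nat

theorem norm_qPochInf_sub_one_le (x : ℂ) {q : ℂ} (hq : ‖q‖ < 1) :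
    ‖qPochInf x q - 1‖ ≤ qPochBound x q - 1 :=
  le_of_tendsto ((tendsto_qPoch x hq).sub_const 1).norm
    (Eventually.of_forall (norm_qPoch_sub_one_le x hq))

theorem norm_qPochInf_le (x : ℂ) {q : ℂ} (hq : ‖q‖ < 1) :
    ‖qPochInf x q‖ ≤ qPochBound x q :=
  le_of_tendsto (tendsto_qPoch x hq).norm (Eventually.of_forall (norm_qPoch_le x hq))

theorem tendsto_qPochInf {q : ℂ} (hq : ‖q‖ < 1) {u : ℕ → ℂ} (hu : Tendsto u atTop (𝓝 0)) :
    Tendsto (fun N => qPochInf (u N) q) atTop (𝓝 1) := by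
  rw [tendsto_iff_norm_sub_tendsto_zero]
  refine squeeze_zero (fun _ => norm_nonneg _) (fun N => norm_qPochInf_sub_one_le (u N) hq) ?_
  have h : Tendsto (fun N => Real.exp (‖u N‖ * (1 - ‖q‖)⁻¹) - 1) atTop
      (𝓝 (Real.exp (‖(0 : ℂ)‖ * (1 - ‖q‖)⁻¹) - 1)) :=
    ((Real.continuous_exp.tendsto _).comp (hu.norm.mul_const _)).sub_const 1
  simpa [qPochBound] using h

theorem tendsto_qPoch_arg {q x : ℂ} {u : ℕ → ℂ} (hu : Tendsto u atTop (𝓝 x)) (n : ℕ) :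
    Tendsto (fun N => qPoch (u N) q n) atTop (𝓝 (qPoch x q n)) :=
  tendsto_finsetProd _ fun _ _ => (hu.mul_const _).const_sub 1

theorem qPochInf_ne_zero {x q : ℂ} (hq : ‖q‖ < 1) (hx : ∀ n : ℕ, x * q ^ n ≠ 1) :
    qPochInf x q ≠ 0 := by
  have h : Summable fun i : ℕ => ‖-(x * q ^ i)‖ := by
    simp only [norm_neg, norm_mul, norm_pow]
    exact (summable_geometric_of_lt_one (norm_nonneg q) hq).mul_left _
  have := tprod_one_add_ne_zero_of_summable (f := fun i : ℕ => -(x * q ^ i))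
    (fun i => by rw [← sub_eq_add_neg, sub_ne_zero]; exact (hx i).symm) h
  simpa [qPochInf, sub_eq_add_neg] using this

theorem mul_pow_ne_one {q : ℂ} (hq : ‖q‖ < 1) (n : ℕ) : q * q ^ n ≠ 1 := by
  intro h
  have h1 := norm_mul_pow_le q hq n
  rw [h, norm_one] at h1
  linarith

theorem qPoch_ne_zero {x q : ℂ} (hx : ∀ n : ℕ, x * q ^ n ≠ 1) (n : ℕ) : qPoch x q n ≠ 0 :=
  Finset.prod_ne_zero_iff.2 fun i _ => sub_ne_zero.2 (hx i).symm

theorem qPochInf_eq (x : ℂ) {q : ℂ} (hq : ‖q‖ < 1) :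
    qPochInf x q = (1 - x) * qPochInf (x * q) q := by
  simpa [qPoch] using (qPoch_mul_qPochInf x hq 1).symm

theorem qPoch_succ (x q : ℂ) (n : ℕ) : qPoch x q (n + 1) = qPoch x q n * (1 - x * q ^ n) :=
  Finset.prod_range_succ _ _

theorem qPoch_add (x q : ℂ) (m n : ℕ) :
    qPoch x q (m + n) = qPoch x q m * qPoch (x * q ^ m) q n := by
  simp only [qPoch, Finset.prod_range_add, pow_add, mul_assoc]

theorem qPoch_succ' (x q : ℂ) (n : ℕ) : qPoch x q (n + 1) = (1 - x) * qPoch (x * q) q n := by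
  rw [add_comm, qPoch_add]
  simp [qPoch]

theorem exists_norm_inv_qPoch_le {q : ℂ} (hq : ‖q‖ < 1) :
    ∃ C : ℝ, 0 ≤ C ∧ ∀ n, ‖(qPoch q q n)⁻¹‖ ≤ C := by
  have h := (tendsto_qPoch q hq).inv₀ (qPochInf_ne_zero hq (mul_pow_ne_one hq))
  obtain ⟨C, hC⟩ := (Metric.isBounded_range_of_tendsto _ h).exists_norm_le
  exact ⟨C, (norm_nonneg _).trans (hC _ ⟨0, rfl⟩), fun n => hC _ ⟨n, rfl⟩⟩

/-! ### The three-parameter sum -/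

/-- The term `(a q^n, b q^n;q)_∞ (c q^n;q)_n / (q;q)_n · q^n`. -/
noncomputable def cTerm (q a b c : ℂ) (n : ℕ) : ℂ :=
  qPochInf (a * q ^ n) q * qPochInf (b * q ^ n) q * qPoch (c * q ^ n) q n / qPoch q q n * q ^ n

theorem cTerm_comm (q a b c : ℂ) : cTerm q a b c = cTerm q b a c := by
  funext n
  simp only [cTerm, mul_comm (qPochInf (a * q ^ n) q)]

/-- One K serves all parameters in the given discs; this is the domination needed to pass to the
limit in the parameters. -/
theorem exists_norm_cTerm_le {q : ℂ} (hq : ‖q‖ < 1) (A B C : ℂ) :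
    ∃ K : ℝ, ∀ a b c : ℂ, ‖a‖ ≤ ‖A‖ → ‖b‖ ≤ ‖B‖ → ‖c‖ ≤ ‖C‖ →
      ∀ n, ‖cTerm q a b c n‖ ≤ K * ‖q‖ ^ n := by
  obtain ⟨D, hD0, hD⟩ := exists_norm_inv_qPoch_le hq
  refine ⟨qPochBound A q * qPochBound B q * qPochBound C q * D, fun a b c ha hb hc n => ?_⟩
  have hA := (norm_qPochInf_le (a * q ^ n) hq).trans
    (qPochBound_mono hq ((norm_mul_pow_le a hq n).trans ha))
  have hB := (norm_qPochInf_le (b * q ^ n) hq).trans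
    (qPochBound_mono hq ((norm_mul_pow_le b hq n).trans hb))
  have hC := (norm_qPoch_le (c * q ^ n) hq n).trans
    (qPochBound_mono hq ((norm_mul_pow_le c hq n).trans hc))
  have pA := (qPochBound_pos A q).le
  have pB := (qPochBound_pos B q).le
  have pC := (qPochBound_pos C q).le
  have hDn := hD n
  rw [cTerm, div_eq_mul_inv, norm_mul, norm_mul, norm_mul, norm_mul, norm_pow]
  gcongr

theorem summable_cTerm {q : ℂ} (hq : ‖q‖ < 1) (a b c : ℂ) : Summable (cTerm q a b c) := by
  obtain ⟨K, hK⟩ := exists_norm_cTerm_le hq a b c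
  exact ((summable_geometric_of_lt_one (norm_nonneg q) hq).mul_left K).of_norm_bounded
    (hK a b c le_rfl le_rfl le_rfl)

/-- `∑ (a q^n, b q^n;q)_∞ (c q^n;q)_n / (q;q)_n · q^n`. -/
noncomputable def cSum (q a b c : ℂ) : ℂ := ∑' n : ℕ, cTerm q a b c n

theorem cSum_comm (q a b c : ℂ) : cSum q a b c = cSum q b a c := by
  rw [cSum, cTerm_comm, cSum]

theorem tendsto_pow_mul {q : ℂ} (hq : ‖q‖ < 1) (a : ℂ) :
    Tendsto (fun N : ℕ => a * q ^ N) atTop (𝓝 0) := by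
  simpa using (tendsto_pow_atTop_nhds_zero_of_norm_lt_one hq).const_mul a

theorem tendsto_cSum {q : ℂ} (hq : ‖q‖ < 1) (a b d : ℂ) :
    Tendsto (fun N : ℕ => cSum q (a * q ^ N) b (a * q ^ N * d)) atTop (𝓝 (cSum q 0 b 0)) := by
  obtain ⟨K, hK⟩ := exists_norm_cTerm_le hq a b (a * d)
  have h0 := tendsto_pow_mul hq a
  refine tendsto_tsum_of_dominated_convergence
    ((summable_geometric_of_lt_one (norm_nonneg q) hq).mul_left K) (fun n => ?_)
    (Eventually.of_forall fun N n => hK _ _ _ (norm_mul_pow_le a hq N) le_rfl ?_ n)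
  · have h1 := tendsto_qPochInf hq (u := fun N => a * q ^ N * q ^ n)
      (by simpa using h0.mul_const (q ^ n))
    have h2 := tendsto_qPoch_arg (q := q) (u := fun N => a * q ^ N * d * q ^ n) (x := 0 * q ^ n)
      (by simpa using (h0.mul_const d).mul_const (q ^ n)) n
    have e : qPochInf (0 * q ^ n) q = 1 := by simp [qPochInf]
    have := (((h1.mul_const (qPochInf (b * q ^ n) q)).mul h2).div_const
      (qPoch q q n)).mul_const (q ^ n)
    simpa only [cTerm, e] using this
  · rw [norm_mul _ d, norm_mul a d]
    gcongr
    exact norm_mul_pow_le a hq N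

/-! ### Factorization at c = ab/q -/

/-- The termwise contiguous relation behind the functional equation in `a`. -/
theorem cTerm_shift {q : ℂ} (hq0 : q ≠ 0) (hq : ‖q‖ < 1) (a b : ℂ) (n : ℕ) :
    cTerm q a b (a * (b / q)) (n + 1) =
      (1 - a) * cTerm q (a * q) b (a * q * (b / q)) (n + 1) +
        a * q * cTerm q (a * q * q) b (a * q * q * (b / q)) n := by
  have e1 : qPochInf (a * q ^ (n + 1)) q =
      (1 - a * q ^ (n + 1)) * qPochInf (a * q * q * q ^ n) q := by
    rw [qPochInf_eq _ hq]; congr 2; ring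
  have e2 : qPochInf (b * q ^ n) q = (1 - b * q ^ n) * qPochInf (b * q ^ (n + 1)) q := by
    rw [qPochInf_eq _ hq]; congr 2; ring
  have e3 : a * q * q ^ (n + 1) = a * q * q * q ^ n := by ring
  have e4 : qPoch (a * (b / q) * q ^ (n + 1)) q (n + 1) =
      (1 - a * b * q ^ n) * qPoch (a * b * q * q ^ n) q n := by
    rw [qPoch_succ']
    congr 2
    · field_simp
      ring
    · field_simp
      ring
  have e5 : qPoch (a * q * (b / q) * q ^ (n + 1)) q (n + 1) =
      qPoch (a * b * q * q ^ n) q n * (1 - a * b * q * q ^ n * q ^ n) := by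
    have : a * q * (b / q) * q ^ (n + 1) = a * b * q * q ^ n := by
      field_simp
      ring
    rw [this, qPoch_succ]
  have e6 : a * q * q * (b / q) * q ^ n = a * b * q * q ^ n := by field_simp
  have e7 := qPoch_succ q q n
  have h8 := qPoch_ne_zero (mul_pow_ne_one hq) n
  have h9 : 1 - q * q ^ n ≠ 0 := sub_ne_zero.2 (mul_pow_ne_one hq n).symm
  -- All three terms now share (aq^{n+2}, bq^{n+1};q)_∞ (abq^{n+1};q)_n; what remains is a rational
  -- identity in q^n.
  simp only [cTerm, e1, e2, e3, e4, e5, e6, e7]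
  field_simp
  ring

theorem cSum_shift {q : ℂ} (hq0 : q ≠ 0) (hq : ‖q‖ < 1) (a b : ℂ) :
    cSum q a b (a * (b / q)) = (1 - a) * cSum q (a * q) b (a * q * (b / q)) +
      a * q * cSum q (a * q * q) b (a * q * q * (b / q)) := by
  have s1 := summable_cTerm hq a b (a * (b / q))
  have s2 := summable_cTerm hq (a * q) b (a * q * (b / q))
  have s3 := summable_cTerm hq (a * q * q) b (a * q * q * (b / q))
  have h0 : cTerm q a b (a * (b / q)) 0 =
      (1 - a) * cTerm q (a * q) b (a * q * (b / q)) 0 := by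
    simp only [cTerm, pow_zero, mul_one, qPoch, Finset.range_zero, Finset.prod_empty, div_one]
    rw [qPochInf_eq a hq, mul_assoc]
  rw [cSum, cSum, cSum, s1.tsum_eq_zero_add, s2.tsum_eq_zero_add, h0, mul_add, add_assoc,
    ← tsum_mul_left, ← tsum_mul_left,
    ← (((summable_nat_add_iff 1).2 s2).mul_left _).tsum_add (s3.mul_left _)]
  congr 1
  exact tsum_congr (cTerm_shift hq0 hq a b)

/-- The three-term relation says exactly that the left side is invariant under a ↦ aq, so it equals
its limit along aq^N. -/
theorem cSum_functional {q : ℂ} (hq0 : q ≠ 0) (hq : ‖q‖ < 1) (a b : ℂ) :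
    cSum q a b (a * (b / q)) + a * cSum q (a * q) b (a * q * (b / q)) = cSum q 0 b 0 := by
  set H : ℂ → ℂ := fun x => cSum q x b (x * (b / q)) + x * cSum q (x * q) b (x * q * (b / q))
    with hH
  have hstep : ∀ x, H x = H (x * q) := fun x => by
    simp only [hH]
    linear_combination cSum_shift hq0 hq x b
  have hiter : ∀ N : ℕ, H (a * q ^ N) = H a := by
    intro N
    induction N with
    | zero => simp
    | succ k ih => rw [← ih, hstep (a * q ^ k), pow_succ, mul_assoc]
  have hlim : Tendsto (fun N : ℕ => H (a * q ^ N)) atTop (𝓝 (cSum q 0 b 0)) := by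
    have h1 := tendsto_cSum hq a b (b / q)
    have h2 := (tendsto_pow_mul hq a).mul ((tendsto_add_atTop_iff_nat 1).2 h1)
    simpa [hH, pow_succ, mul_assoc] using h1.add h2
  simp only [hiter] at hlim
  exact tendsto_nhds_unique tendsto_const_nhds hlim

theorem partialTheta_functional (x : ℂ) {q : ℂ} (hq : ‖q‖ < 1) :
    partialTheta q x = 1 - x * partialTheta q (x * q) := by
  rw [partialTheta, (summable_partialTheta x hq).tsum_eq_zero_add, partialTheta, ← tsum_mul_left,
    sub_eq_add_neg, ← tsum_neg]
  congr 1
  · simp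
  · refine tsum_congr fun n => ?_
    rw [Nat.choose_succ_succ' n 1, Nat.choose_one_right]
    ring

/-- An iteration argument: a solution of `g x = -x g(x q)` that converges along `a q^N` vanishes at `a`. -/
theorem eq_zero_of_functional {q a l : ℂ} (hq : ‖q‖ < 1) {g : ℂ → ℂ}
    (hg : ∀ x, g x = -x * g (x * q)) (hl : Tendsto (fun N : ℕ => g (a * q ^ N)) atTop (𝓝 l)) :
    g a = 0 := by
  have hiter : ∀ N : ℕ, g a = (-1) ^ N * q ^ (N.choose 2) * a ^ N * g (a * q ^ N) := by
    intro N
    induction N with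
    | zero => simp
    | succ k ih =>
      rw [ih, hg (a * q ^ k), Nat.choose_succ_succ' k 1, Nat.choose_one_right]
      ring_nf
  -- The iterated prefactor is the N-th term of the series for θ(q,a), hence tends to 0.
  have h := (summable_partialTheta a hq).tendsto_atTop_zero.mul hl
  simp only [← hiter, zero_mul] at h
  exact tendsto_nhds_unique tendsto_const_nhds h

theorem tendsto_partialTheta {q : ℂ} (hq : ‖q‖ < 1) (a : ℂ) :
    Tendsto (fun N : ℕ => partialTheta q (a * q ^ N)) atTop (𝓝 (partialTheta q 0)) := by
  refine tendsto_tsum_of_dominated_convergence (summable_partialTheta a hq).norm (fun n => ?_)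
    (Eventually.of_forall fun N n => ?_)
  · exact ((tendsto_pow_mul hq a).pow n).const_mul _
  · simp only [norm_mul _ (_ ^ n), norm_pow _ n]
    gcongr
    exact norm_mul_pow_le a hq N

theorem cSum_eq_mul_partialTheta {q : ℂ} (hq0 : q ≠ 0) (hq : ‖q‖ < 1) (a b : ℂ) :
    cSum q a b (a * (b / q)) = cSum q 0 b 0 * partialTheta q a := by
  refine sub_eq_zero.1 (eq_zero_of_functional
    (g := fun x => cSum q x b (x * (b / q)) - cSum q 0 b 0 * partialTheta q x) hq (fun x => ?_)
    ((tendsto_cSum hq a b (b / q)).sub ((tendsto_partialTheta hq a).const_mul _)))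
  linear_combination cSum_functional hq0 hq x b -
    cSum q 0 b 0 * partialTheta_functional x hq

/-- The partial sums telescope: ∑_{n≤N} q^n/(q;q)_n = 1/(q;q)_N. -/
theorem cSum_zero {q : ℂ} (hq : ‖q‖ < 1) : cSum q 0 0 0 = (qPochInf q q)⁻¹ := by
  have hne := qPoch_ne_zero (mul_pow_ne_one hq)
  have hterm : ∀ n, cTerm q 0 0 0 n = (qPoch q q n)⁻¹ * q ^ n := fun n => by
    simp [cTerm, qPochInf, qPoch]
  have hpart : ∀ N, ∑ n ∈ Finset.range (N + 1), cTerm q 0 0 0 n = (qPoch q q N)⁻¹ := by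
    intro N
    induction N with
    | zero => simp [hterm, qPoch]
    | succ k ih =>
      have h1 := hne k
      have h2 : 1 - q * q ^ k ≠ 0 := sub_ne_zero.2 (mul_pow_ne_one hq k).symm
      rw [Finset.sum_range_succ, ih, hterm, qPoch_succ]
      field_simp
      ring
  have h1 := (tendsto_add_atTop_iff_nat 1).2 (summable_cTerm hq 0 0 0).hasSum.tendsto_sum_nat
  simp only [hpart] at h1
  exact tendsto_nhds_unique h1
    ((tendsto_qPoch q hq).inv₀ (qPochInf_ne_zero hq (mul_pow_ne_one hq)))

/-- The Andrews–Warnaar product formula for partial theta functions. -/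
theorem qPochInf_mul_cSum {q : ℂ} (hq0 : q ≠ 0) (hq : ‖q‖ < 1) (a b : ℂ) :
    qPochInf q q * cSum q a b (a * b / q) = partialTheta q a * partialTheta q b := by
  -- The constant S(0,b,0) is the same factorization with the roles exchanged and the other
  -- parameter 0.
  have h1 := cSum_eq_mul_partialTheta hq0 hq b 0
  rw [zero_div, mul_zero, cSum_comm, cSum_zero hq] at h1
  rw [mul_div_assoc, cSum_eq_mul_partialTheta hq0 hq, h1]
  field_simp [qPochInf_ne_zero hq (mul_pow_ne_one hq)]

/-! ### Lowering c to ab/q² and ab/q³ -/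

theorem cTerm_div_left {q : ℂ} (hq0 : q ≠ 0) (hq : ‖q‖ < 1) (a b c : ℂ) (n : ℕ) :
    cTerm q (a / q) b c n = (1 - a / q * q ^ n) * cTerm q a b c n := by
  have : a / q * q ^ n * q = a * q ^ n := by field_simp
  rw [cTerm, qPochInf_eq (a / q * q ^ n) hq, this, cTerm]
  ring

/-- Termwise, b - a = b(1 - aq^{n-1}) - a(1 - bq^{n-1}). -/
theorem sub_mul_cSum {q : ℂ} (hq0 : q ≠ 0) (hq : ‖q‖ < 1) (a b c : ℂ) :
    (b - a) * cSum q a b c = b * cSum q (a / q) b c - a * cSum q a (b / q) c := by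
  rw [cSum, cSum, cSum, ← tsum_mul_left, ← tsum_mul_left, ← tsum_mul_left,
    ← ((summable_cTerm hq _ _ _).mul_left _).tsum_sub ((summable_cTerm hq _ _ _).mul_left _)]
  refine tsum_congr fun n => ?_
  rw [cTerm_div_left hq0 hq, cTerm_comm q a (b / q), cTerm_div_left hq0 hq, cTerm_comm q b a]
  ring

theorem partialTheta_div {q : ℂ} (hq0 : q ≠ 0) (hq : ‖q‖ < 1) (a : ℂ) :
    partialTheta q (a / q) = 1 - a / q * partialTheta q a := by
  rw [partialTheta_functional (a / q) hq, div_mul_cancel₀ a hq0]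

theorem sub_mul_qPochInf_mul_cSum {q : ℂ} (hq0 : q ≠ 0) (hq : ‖q‖ < 1) (a b : ℂ) :
    (b - a) * (qPochInf q q * cSum q a b (a * b / q ^ 2)) =
      b * partialTheta q b - a * partialTheta q a := by
  have h1 := qPochInf_mul_cSum hq0 hq (a / q) b
  have h2 := qPochInf_mul_cSum hq0 hq a (b / q)
  rw [show a / q * b / q = a * b / q ^ 2 by field_simp, partialTheta_div hq0 hq] at h1
  rw [show a * (b / q) / q = a * b / q ^ 2 by field_simp, partialTheta_div hq0 hq] at h2
  linear_combination qPochInf q q * sub_mul_cSum hq0 hq a b (a * b / q ^ 2) + b * h1 - a * h2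

theorem PCancelledTerm_eq (q a b : ℂ) :
    PCancelledTerm q a b = cTerm q a b (a * b / q ^ 3) := rfl

theorem thetaSide_eq {q a b : ℂ} (hq0 : q ≠ 0) (hq : ‖q‖ < 1) (ha : a ≠ 0) (hb : b ≠ 0)
    (hab : a ≠ b) :
    thetaSide q a b = -((a - b * q) * (b - a * q) / (a ^ 2 * b ^ 2)) * PCancelled q a b := by
  have h1 := sub_mul_qPochInf_mul_cSum hq0 hq (a / q) b
  have h2 := sub_mul_qPochInf_mul_cSum hq0 hq a (b / q)
  rw [show a / q * b / q ^ 2 = a * b / q ^ 3 by field_simp, partialTheta_div hq0 hq] at h1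
  rw [show a * (b / q) / q ^ 2 = a * b / q ^ 3 by field_simp, partialTheta_div hq0 hq] at h2
  have h3 : (b - a) * PCancelled q a b =
      b * (qPochInf q q * cSum q (a / q) b (a * b / q ^ 3)) -
        a * (qPochInf q q * cSum q a (b / q) (a * b / q ^ 3)) := by
    have := sub_mul_cSum hq0 hq a b (a * b / q ^ 3)
    rw [PCancelled, PCancelledTerm_eq, ← cSum]
    linear_combination qPochInf q q * this
  generalize qPochInf q q * cSum q (a / q) b (a * b / q ^ 3) = X at h1 h3
  generalize qPochInf q q * cSum q a (b / q) (a * b / q ^ 3) = Y at h2 h3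
  have hd : a - b ≠ 0 := sub_ne_zero.2 hab
  rw [thetaSide]
  generalize partialTheta q a = A at *
  generalize partialTheta q b = B at *
  generalize PCancelled q a b = Z at *
  field_simp at h1 h2 ⊢
  -- Multiplying by b-aq and a-bq instead of dividing keeps the cases b = aq and a = bq included.
  linear_combination -(q * (b - a * q) * (a - b * q)) * h3 + b * (b - a * q) * h1 +
    a * (a - b * q) * h2

/-! ### Comparison with the uncancelled series -/

theorem PTerm_eq {q a b : ℂ} (hq : ‖q‖ < 1) (ha : ∀ n : ℕ, a * q ^ n ≠ 1)
    (hb : ∀ n : ℕ, b * q ^ n ≠ 1) (hc : ∀ n : ℕ, a * b / q ^ 3 * q ^ n ≠ 1) (n : ℕ) :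
    PTerm q a b n = (qPochInf a q * qPochInf b q)⁻¹ * PCancelledTerm q a b n := by
  have a1 := qPoch_mul_qPochInf a hq n
  have b1 := qPoch_mul_qPochInf b hq n
  have a2 := qPochInf_ne_zero hq ha
  have b2 := qPochInf_ne_zero hq hb
  rw [← a1] at a2
  rw [← b1] at b2
  have a3 := left_ne_zero_of_mul a2
  have a4 := right_ne_zero_of_mul a2
  have b3 := left_ne_zero_of_mul b2
  have b4 := right_ne_zero_of_mul b2
  have c3 := qPoch_ne_zero hc n
  have q3 := qPoch_ne_zero (mul_pow_ne_one hq) n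
  rw [PTerm, PCancelledTerm, ← a1, ← b1, two_mul, qPoch_add]
  field_simp

theorem P_eq_PCancelled {q a b : ℂ} (hq : ‖q‖ < 1) (ha : ∀ n : ℕ, a * q ^ n ≠ 1)
    (hb : ∀ n : ℕ, b * q ^ n ≠ 1) (hc : ∀ n : ℕ, a * b / q ^ 3 * q ^ n ≠ 1) :
    P q a b = PCancelled q a b := by
  have a2 := qPochInf_ne_zero hq ha
  have b2 := qPochInf_ne_zero hq hb
  rw [P, PCancelled, tsum_congr (PTerm_eq hq ha hb hc), tsum_mul_left]
  field_simp

end PartialThetaIdentity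

theorem mainTheorem6 (q a b : ℂ) (hq0 : q ≠ 0) (hq1 : ‖q‖ < 1)
    (ha : a ≠ 0) (hb : b ≠ 0) (hab : a ≠ b) :
    -- the identity wherever every term of the series defining `P(a,b)` is literally defined
    ((∀ n : ℕ, a * q ^ n ≠ 1) → (∀ n : ℕ, b * q ^ n ≠ 1) →
      (∀ n : ℕ, a * b / q ^ 3 * q ^ n ≠ 1) →
        Summable (PartialThetaIdentity.PTerm q a b) ∧
        PartialThetaIdentity.thetaSide q a b =
          -((a - b * q) * (b - a * q) / (a ^ 2 * b ^ 2)) * PartialThetaIdentity.P q a b) ∧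
    -- the identity for all `a`, `b`, with the common factors in `P(a,b)` cancelled
    (Summable (PartialThetaIdentity.PCancelledTerm q a b) ∧
      PartialThetaIdentity.thetaSide q a b =
        -((a - b * q) * (b - a * q) / (a ^ 2 * b ^ 2)) *
          PartialThetaIdentity.PCancelled q a b) := by
  have hs : Summable (PartialThetaIdentity.PCancelledTerm q a b) :=
    PartialThetaIdentity.summable_cTerm hq1 _ _ _
  have h := PartialThetaIdentity.thetaSide_eq hq0 hq1 ha hb hab
  refine ⟨fun h1 h2 h3 => ⟨?_, ?_⟩, hs, h⟩
  · exact (hs.mul_left _).congr fun n => (PartialThetaIdentity.PTerm_eq hq1 h1 h2 h3 n).symm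
  · rw [PartialThetaIdentity.P_eq_PCancelled hq1 h1 h2 h3, h]
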